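/- Let $k, n$ be positive integers with $k \ge 2$, and let $m$ be a positive integer or $m = \infty$. A $k$-multiset of $[n]_m$ is a multiset of $k$ elements (counted with repetition) of $[n] = \{1, \dots, n\}$ in which each element occurs at most $m$ times (arbitrarily often if $m = \infty$). Let $\binom{[n]_m}{k}$ be the set of all of them, and put $\lceil k/\infty \rceil := 1$. A family $\mathcal{A} \subseteq \binom{[n]_m}{k}$ is called intersecting if $|A_1 \cap A_2| \ge 1$ for all $A_1, A_2 \in \mathcal{A}$. Two families $\mathcal{A}_1, \mathcal{A}_2$ are called isomorphic, written $\mathcal{A}_1 \cong \mathcal{A}_2$, if $\mathcal{A}_2 = \{\sigma(A) : A \in \mathcal{A}_1\}$ for some permutation $\sigma$ of $[n]$. Let $\mathcal{F}_{0,1}^{(m)} = \{A \in \binom{[n]_m}{k} : |A \cap \{1\}| \ge 1\}$ be the star of all $k$-multisets of $[n]_m$ that contain the element $1$. Suppose that $n \ge k + \lceil k/m \rceil$ and that $\mathcal{A} \subseteq \binom{[n]_m}{k}$ is an intersecting family. Then $|\mathcal{A}| \le |\mathcal{F}_{0,1}^{(m)}|$. Moreover, if (a) $n > k + \lceil k/m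 \rceil$, or (b) $n = k + \lceil k/m \rceil$, $k > m$ and $m \nmid k$, then $|\mathcal{A}| = |\mathcal{F}_{0,1}^{(m)}|$ if and only if $\mathcal{A} \cong \mathcal{F}_{0,1}^{(m)}$. -/

import Mathlib

namespace MultisetEKR

/-- The `k`-multisets of `[n]_m`: multisets of cardinality `k` (with repetitions) on the ground set
`[n]`, modelled by `Fin n`, in which every element occurs at most `m` times.
The value `m = ⊤` is the unbounded case. -/
def kMultisets (n : ℕ) (m : ℕ∞) (k : ℕ) : Finset (Multiset (Fin n)) :=
  (Finset.univ.image (fun s : Sym (Fin n) k => (s : Multiset (Fin n)))).filter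
    (fun A => ∀ i, (A.count i : ℕ∞) ≤ m)

theorem mem_kMultisets {n : ℕ} {m : ℕ∞} {k : ℕ} {A : Multiset (Fin n)} :
    A ∈ kMultisets n m k ↔ A.card = k ∧ ∀ i, (A.count i : ℕ∞) ≤ m := by
  simp only [kMultisets, Finset.mem_filter, Finset.mem_image, Finset.mem_univ, true_and]
  refine and_congr_left fun _ => ⟨?_, fun h => ⟨⟨A, h⟩, rfl⟩⟩
  rintro ⟨B, rfl⟩
  exact B.2

/-- The initial segment consisting of the first `r` elements of the ground set, each taken once. -/
def initSeg (n r : ℕ) : Multiset (Fin n) :=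
  ((Finset.univ : Finset (Fin n)).filter (fun i => i.val < r)).val

/-- The family `F_{s,t}` of the `k`-multisets `A` of `[n]_m` with `|A ∩ [2s+t]| ≥ s + t`.
For `s = 0`, `t = 1` it is the star of the first element. -/
def frankl (n : ℕ) (m : ℕ∞) (k s t : ℕ) : Finset (Multiset (Fin n)) :=
  (kMultisets n m k).filter (fun A => s + t ≤ (A ∩ initSeg n (2 * s + t)).card)

/-- A family is `t`-intersecting if any two of its members (possibly equal) have a multiset
intersection of cardinality at least `t`. -/
def IsTIntersecting {n : ℕ} (t : ℕ) (𝒜 : Finset (Multiset (Fin n))) : Prop :=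
  ∀ A₁ ∈ 𝒜, ∀ A₂ ∈ 𝒜, t ≤ (A₁ ∩ A₂).card

/-- Two families are isomorphic if a permutation of the ground set carries one to the other. -/
def Isomorphic {n : ℕ} (𝒜₁ 𝒜₂ : Finset (Multiset (Fin n))) : Prop :=
  ∃ σ : Equiv.Perm (Fin n), 𝒜₂ = 𝒜₁.image (Multiset.map σ)

/-- `⌈k / m⌉`, read as `1` when `m = ∞`. -/
noncomputable def ceilQuot (k : ℕ) (m : ℕ∞) : ℕ :=
  if m = ⊤ then 1 else ⌈(k : ℚ) / (m.toNat : ℚ)⌉₊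

end MultisetEKR

namespace MultisetEKR

/-! ### Compositions with bounded parts -/

/-! Sort the multisets by support. The number of `k`-multisets with a given support of size `j` is a
weight `w j`, the number of compositions of `k` into `j` parts of size at most `m`. The supports of
an intersecting family form an intersecting family of sets, so it suffices to compare the weighted
level sizes of such a family with those of a star.

Pair level `i ≤ n / 2` with level `n - i`. By complementation the two levels have at most `n.choose
i` sets in all, and by Erdős–Ko–Rado level `i` has at most `(n - 1).choose (i - 1)`; a star attains
both bounds. As `w (n - i) ≤ w i` for `i ≥ 1` (`headComp_le_headComp`, where `n ≥ k + ⌈k / m⌉`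
enters), a star is optimal for each pair.

For equality, put `c = ⌈k / m⌉`. In cases (a) and (b), `w (n - c) < w c`, so level `c` must be
extremal. The uniqueness part of Erdős–Ko–Rado (`exists_eq_star`, by Katona's cycle method) makes it
a star, and its centre then lies in every support. -/

/-- The number of compositions of `k` into `j` parts, each of size between `1` and `m`. -/
def boundedComp (m : ℕ) : ℕ → ℕ → ℕ
  | k, 0 => if k = 0 then 1 else 0
  | k, j + 1 => ∑ r ∈ Finset.range m, if r < k then boundedComp m (k - 1 - r) j else 0

/-- The number of compositions of `k` into `j + 1` parts, the first of which is at most `M` and the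
others of which are at most `m`. -/
def headComp (m k M j : ℕ) : ℕ :=
  ∑ r ∈ Finset.range M, if r < k then boundedComp m (k - 1 - r) j else 0

theorem boundedComp_zero_right (m k : ℕ) : boundedComp m k 0 = if k = 0 then 1 else 0 := by
  rw [boundedComp]

theorem boundedComp_succ (m k j : ℕ) : boundedComp m k (j + 1) = headComp m k m j := by
  rw [boundedComp, headComp]

theorem boundedComp_eq_zero_of_lt {m k j : ℕ} (h : k < j) : boundedComp m k j = 0 := by
  induction j generalizing k with
  | zero => omega
  | succ j ih =>
    rw [boundedComp_succ, headComp]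
    refine Finset.sum_eq_zero fun r _ => ?_
    split_ifs with hr
    · exact ih (by omega)
    · rfl

theorem headComp_zero_left (m M j : ℕ) : headComp m 0 M j = 0 := by simp [headComp]

/-- Either the first part is 1 and is deleted, or it is at least 2 and is lowered by 1. -/
theorem headComp_succ_succ (m k M j : ℕ) :
    headComp m (k + 1) (M + 1) j = boundedComp m k j + headComp m k M j := by
  rw [headComp, Finset.sum_range_succ', headComp, add_comm]
  simp only [Nat.zero_lt_succ, if_true, Nat.add_lt_add_iff_right]
  congr 1
  refine Finset.sum_congr rfl fun r _ => ?_
  rw [show k + 1 - 1 - (r + 1) = k - 1 - r by omega]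

theorem headComp_add (m k M M' j : ℕ) :
    headComp m k (M + M') j = headComp m k M j + headComp m (k - M) M' j := by
  rw [headComp, Finset.sum_range_add, headComp, headComp]
  congr 1
  refine Finset.sum_congr rfl fun r _ => ?_
  rw [show k - 1 - (M + r) = k - M - 1 - r by omega]
  simp only [show M + r < k ↔ r < k - M by omega]

theorem headComp_eq_zero_of_le {m k M j : ℕ} (h : k ≤ j) : headComp m k M j = 0 := by
  rw [headComp]
  refine Finset.sum_eq_zero fun r _ => ?_
  split_ifs with hr
  · exact boundedComp_eq_zero_of_lt (by omega)
  · rfl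

theorem boundedComp_self_le_one (m k : ℕ) : boundedComp m k k ≤ 1 := by
  induction k with
  | zero => simp [boundedComp_zero_right]
  | succ k ih =>
    rcases m with _ | m
    · simp [boundedComp_succ, headComp]
    · rw [boundedComp_succ, headComp_succ_succ, headComp_eq_zero_of_le le_rfl]
      exact ih

/-- The numbers of compositions decrease when the number of parts is reflected in a point that is
large enough. -/
theorem headComp_le_headComp {m k M q i j : ℕ} (hM : 1 ≤ M) (hMm : M ≤ m) (hk : k ≤ M + q * m)
    (hij : i < j) (h : k + q ≤ i + j + 1) : headComp m k M j ≤ headComp m k M i := by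
  induction k using Nat.strong_induction_on generalizing M q i j with
  | _ k ih =>
  obtain rfl | ⟨k, rfl⟩ : k = 0 ∨ ∃ k', k = k' + 1 := by cases k <;> simp
  · simp [headComp_zero_left]
  obtain ⟨M, rfl⟩ : ∃ M', M = M' + 1 := ⟨M - 1, by omega⟩
  by_cases hkj : k + 1 ≤ j
  · rw [headComp_eq_zero_of_le hkj]; exact Nat.zero_le _
  obtain ⟨j, rfl⟩ : ∃ j', j = j' + 1 := ⟨j - 1, by omega⟩
  obtain rfl | ⟨i, rfl⟩ : i = 0 ∨ ∃ i', i = i' + 1 := by cases i <;> simp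
  · -- here `q = 0` and `j = k`
    obtain rfl : q = 0 := by omega
    obtain rfl : k = j + 1 := by omega
    rw [headComp_succ_succ, headComp_eq_zero_of_le le_rfl, add_zero]
    -- As `q = 0`, the whole number fits into the single first part, so the right side is at least
    -- 1.
    refine (boundedComp_self_le_one _ _).trans ?_
    rw [headComp]
    refine le_trans ?_ (Finset.single_le_sum (fun _ _ => Nat.zero_le _)
      (Finset.mem_range.2 (show j + 1 < M + 1 by omega)))
    simp [boundedComp_zero_right]
  rw [headComp_succ_succ, headComp_succ_succ, boundedComp_succ, boundedComp_succ]
  obtain rfl | hM0 : M = 0 ∨ 1 ≤ M := by omega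
  -- The first part is forced to be 1. Deleting it frees the next part up to `m`, which uses up one
  -- of the `q` multiples of `m`.
  · obtain ⟨q, rfl⟩ : ∃ q', q = q' + 1 := by
      refine ⟨q - 1, ?_⟩
      rcases q with _ | q <;> omega
    have := ih k (by omega) (M := m) (q := q) (i := i) (j := j) (by omega) le_rfl
      (by rw [add_mul] at hk; omega) (by omega) (by omega)
    simpa [headComp] using this
  -- Cut the bound `m` at `M` and compare crosswise: `j + 1` with `i`, and `j` with `i + 1`. Both
  -- pairs keep the index sum `i + j + 1`, while the number composed has dropped by 1.
  · obtain ⟨M', rfl⟩ := Nat.exists_eq_add_of_lt (show M < m by omega)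
    rw [show M + M' + 1 = M + (M' + 1) by omega, headComp_add _ _ M (M' + 1) j,
      headComp_add _ _ M (M' + 1) i]
    rw [show M + M' + 1 = M + (M' + 1) by omega] at ih hk
    have e1 : headComp (M + (M' + 1)) k M (j + 1) ≤ headComp (M + (M' + 1)) k M i :=
      ih k (by omega) (q := q) hM0 (by omega) (by omega) (by omega) (by omega)
    have e2 : headComp (M + (M' + 1)) k M j ≤ headComp (M + (M' + 1)) k M (i + 1) := by
      rcases (show i + 1 = j ∨ i + 1 < j by omega) with rfl | hlt
      · exact le_rfl
      · exact ih k (by omega) (q := q) hM0 (by omega) (by omega) (by omega) (by omega)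
    have e3 : headComp (M + (M' + 1)) (k - M) (M' + 1) j ≤
        headComp (M + (M' + 1)) (k - M) (M' + 1) i := by
      rcases Nat.eq_zero_or_pos (k - M) with h0 | h0
      · simp [h0, headComp_zero_left]
      · exact ih (k - M) (by omega) (q := q) (by omega) (by omega) (by omega) (by omega)
          (by omega)
    omega

/-- With `i + j = n` the last hypothesis reads `k + c ≤ n`. -/
theorem boundedComp_le_boundedComp {m k c i j : ℕ} (hc : 1 ≤ c) (hk : k ≤ c * m)
    (hi : 1 ≤ i) (hij : i < j) (h : k + c ≤ i + j) : boundedComp m k j ≤ boundedComp m k i := by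
  obtain ⟨c, rfl⟩ : ∃ c', c = c' + 1 := ⟨c - 1, by omega⟩
  obtain ⟨i, rfl⟩ : ∃ i', i = i' + 1 := ⟨i - 1, by omega⟩
  obtain ⟨j, rfl⟩ : ∃ j', j = j' + 1 := ⟨j - 1, by omega⟩
  rw [boundedComp_succ, boundedComp_succ]
  rcases Nat.eq_zero_or_pos m with rfl | hm
  · simp [headComp]
  · exact headComp_le_headComp (q := c) hm le_rfl (by rw [add_mul] at hk; omega) (by omega)
      (by omega)

theorem boundedComp_pos {m k j : ℕ} (hjk : j ≤ k) (hk : k ≤ j * m) : 0 < boundedComp m k j := by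
  induction j generalizing k with
  | zero => simp [boundedComp_zero_right, show k = 0 by simpa using hk]
  | succ j ih =>
    have hm : 1 ≤ m := by
      rcases Nat.eq_zero_or_pos m with rfl | hm
      · omega
      · exact hm
    have hjm : j ≤ j * m := Nat.le_mul_of_pos_right j hm
    rw [add_mul] at hk
    rw [boundedComp_succ, headComp]
    have hr : k - 1 - j * m < m := by omega
    refine lt_of_lt_of_le ?_ (Finset.single_le_sum (fun _ _ => Nat.zero_le _)
      (Finset.mem_range.2 hr))
    rw [if_pos (by omega)]
    exact ih (by omega) (by omega)

theorem one_lt_boundedComp {m k j : ℕ} (hj : 2 ≤ j) (hjk : j < k) (hk : k < j * m) :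
    1 < boundedComp m k j := by
  obtain ⟨j, rfl⟩ : ∃ i, j = i + 1 := ⟨j - 1, by omega⟩
  have hm : 2 ≤ m := by
    rcases m with _ | _ | m <;> omega
  have hjm : j * 2 ≤ j * m := Nat.mul_le_mul_left j hm
  rw [add_mul] at hk
  rw [boundedComp_succ, headComp]
  -- The least first part whose remainder fits into `j` parts is `r + 1`; the strict inequalities
  -- also allow `r + 2`.
  set r := k - 1 - j * m with hr
  have hsub : ({r, r + 1} : Finset ℕ) ⊆ Finset.range m := by
    intro x hx
    simp only [Finset.mem_insert, Finset.mem_singleton] at hx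
    rw [Finset.mem_range]; omega
  refine lt_of_lt_of_le ?_ (Finset.sum_le_sum_of_subset hsub)
  rw [Finset.sum_pair (by omega), if_pos (by omega), if_pos (by omega)]
  have h1 : 0 < boundedComp m (k - 1 - r) j := boundedComp_pos (by omega) (by omega)
  have h2 : 0 < boundedComp m (k - 1 - (r + 1)) j := boundedComp_pos (by omega) (by omega)
  omega

open Finset

/-! ### Cyclic arcs and the extremal families in the Erdős–Ko–Rado theorem -/

section Circle

variable {n : ℕ}

/-- The `r` cyclically consecutive points starting from `i`. -/
def arc (r : ℕ) (i : ZMod n) : Finset (ZMod n) :=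
  (range r).image fun t : ℕ => i + (t : ZMod n)

theorem natCast_ne_natCast {a b : ℕ} (h : a < b) (hn : b < a + n) : (a : ZMod n) ≠ b := by
  intro he
  rw [ZMod.natCast_eq_natCast_iff, Nat.modEq_iff_dvd' h.le] at he
  exact absurd (Nat.le_of_dvd (by omega) he) (by omega)

theorem card_arc {r : ℕ} (hr : r ≤ n) (i : ZMod n) : #(arc r i) = r := by
  rw [arc, card_image_of_injOn, card_range]
  intro a ha b hb hab
  have ha' : a < r := by simpa using ha
  have hb' : b < r := by simpa using hb
  have hab' : (a : ZMod n) = b := add_left_cancel hab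
  by_contra hne
  rcases lt_or_gt_of_ne hne with h | h
  · exact natCast_ne_natCast h (by omega) hab'
  · exact natCast_ne_natCast h (by omega) hab'.symm

theorem disjoint_arc_add {r s : ℕ} (i : ZMod n) (hs : r ≤ s) (hn : s + r ≤ n) :
    Disjoint (arc r i) (arc r (i + (s : ZMod n))) := by
  rw [disjoint_left]
  intro x hx hy
  simp only [arc, mem_image, mem_range] at hx hy
  obtain ⟨a, ha, rfl⟩ := hx
  obtain ⟨b, hb, h⟩ := hy
  rw [add_assoc] at h
  have h' : ((a : ℕ) : ZMod n) = ((s + b : ℕ) : ZMod n) := by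
    push_cast; exact (add_left_cancel h).symm
  exact natCast_ne_natCast (by omega) (by omega) h'

theorem eq_add_or_eq_sub_of_not_disjoint_arc {r : ℕ} {i j : ZMod n} (h : ¬ Disjoint (arc r i) (arc r j)) :
    (∃ t : ℕ, t < r ∧ j = i + (t : ZMod n)) ∨
      (∃ t : ℕ, 1 ≤ t ∧ t < r ∧ j = i - (t : ZMod n)) := by
  rw [not_disjoint_iff] at h
  obtain ⟨x, hx, hy⟩ := h
  simp only [arc, mem_image, mem_range] at hx hy
  obtain ⟨a, ha, rfl⟩ := hx
  obtain ⟨b, hb, h⟩ := hy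
  rcases le_or_gt b a with hba | hba
  · left
    refine ⟨a - b, by omega, ?_⟩
    rw [Nat.cast_sub hba]; linear_combination h
  · right
    refine ⟨b - a, by omega, by omega, ?_⟩
    rw [Nat.cast_sub hba.le]; linear_combination h

/-- Among the starting points of pairwise intersecting arcs, at most one comes from each of the
disjoint pairs of arcs that meet a given one. -/
theorem exists_injOn_of_arcs_intersecting {r : ℕ} (hn : 2 * r ≤ n) {I : Finset (ZMod n)}
    (hI : ∀ i ∈ I, ∀ j ∈ I, ¬ Disjoint (arc r i) (arc r j)) {i : ZMod n} (hi : i ∈ I) :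
    ∃ f : ZMod n → ℕ, Set.InjOn f I ∧ (∀ j ∈ I, f j ∈ range r) ∧
      ∀ j ∈ I, j = i + (f j : ZMod n) ∨ (1 ≤ f j ∧ j = i + (f j : ZMod n) - (r : ZMod n)) := by
  have key : ∀ j ∈ I, ∃ t : ℕ, t < r ∧
      (j = i + (t : ZMod n) ∨ (1 ≤ t ∧ j = i + (t : ZMod n) - (r : ZMod n))) := by
    intro j hj
    rcases eq_add_or_eq_sub_of_not_disjoint_arc (hI i hi j hj) with ⟨t, ht, h⟩ | ⟨t, h1, ht, h⟩
    · exact ⟨t, ht, Or.inl h⟩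
    · refine ⟨r - t, by omega, Or.inr ⟨by omega, ?_⟩⟩
      rw [Nat.cast_sub ht.le, h]; ring
  choose! f hf hf' using key
  refine ⟨f, ?_, fun j hj => mem_range.2 (hf j hj), hf'⟩
  intro a ha b hb hab
  have hdis : ∀ a b : ZMod n, a ∈ I → b ∈ I → b = a + (r : ZMod n) → False := by
    rintro a b ha hb rfl
    exact hI a ha _ hb (disjoint_arc_add a le_rfl (by omega))
  rcases hf' a ha with h1 | ⟨-, h1⟩ <;> rcases hf' b hb with h2 | ⟨-, h2⟩ <;> rw [hab] at h1
  · rw [h1, ← h2]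
  · exact (hdis b a hb ha (by linear_combination h1 - h2)).elim
  · exact (hdis a b ha hb (by linear_combination h2 - h1)).elim
  · rw [h1, ← h2]

theorem card_arcs_le {r : ℕ} (hn : 2 * r ≤ n) {I : Finset (ZMod n)}
    (hI : ∀ i ∈ I, ∀ j ∈ I, ¬ Disjoint (arc r i) (arc r j)) : #I ≤ r := by
  rcases I.eq_empty_or_nonempty with rfl | ⟨i, hi⟩
  · simp
  obtain ⟨f, hf, hr, -⟩ := exists_injOn_of_arcs_intersecting hn hI hi
  simpa using card_le_card_of_injOn f hr hf

/-- Each `t < r` is used, so `I` contains `i + t` or `i + t - r`. For `t = r - 1` the latter is `i -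
1`, which is excluded. Below that, `i + t - r` starts an arc disjoint from the one at `i + t + 1`,
because `2 * r + 1 ≤ n`. -/
theorem mem_of_card_arcs_eq {r : ℕ} (hn : 2 * r < n) {I : Finset (ZMod n)}
    (hI : ∀ i ∈ I, ∀ j ∈ I, ¬ Disjoint (arc r i) (arc r j)) (hcard : #I = r) {i : ZMod n}
    (hi : i ∈ I) (hi' : i - 1 ∉ I) {t : ℕ} (ht : t < r) : i + (t : ZMod n) ∈ I := by
  obtain ⟨f, hf, hr, hf'⟩ := exists_injOn_of_arcs_intersecting hn.le hI hi
  have hsurj : ∀ t, t < r → ∃ j ∈ I, f j = t := by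
    have := surjOn_of_injOn_of_card_le f hr hf (by simp [hcard])
    intro t ht
    obtain ⟨j, hj, h⟩ := this (show t ∈ ((range r : Finset ℕ) : Set ℕ) by simpa using ht)
    exact ⟨j, hj, h⟩
  -- going downwards from `r - 1`
  have key : ∀ s, s < r → i + ((r - 1 - s : ℕ) : ZMod n) ∈ I := by
    intro s
    induction s with
    | zero =>
      intro h0
      obtain ⟨j, hj, hj'⟩ := hsurj (r - 1 - 0) (by omega)
      rcases hf' j hj with h | ⟨-, h⟩ <;> rw [hj'] at h
      · rwa [h] at hj
      · refine absurd hj ?_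
        have : j = i - 1 := by
          rw [h, Nat.sub_zero, Nat.cast_sub (by omega)]; push_cast; ring
        rwa [this]
    | succ s ih =>
      intro hs
      obtain ⟨j, hj, hj'⟩ := hsurj (r - 1 - (s + 1)) (by omega)
      rcases hf' j hj with h | ⟨-, h⟩ <;> rw [hj'] at h
      · rwa [h] at hj
      · have h1 := ih (by omega)
        have : i + ((r - 1 - s : ℕ) : ZMod n) = j + ((r + 1 : ℕ) : ZMod n) := by
          rw [h, show r - 1 - s = r - 1 - (s + 1) + 1 by omega]; push_cast; ring
        rw [this] at h1
        exact (hI j hj _ h1 (disjoint_arc_add j (by omega) (by omega))).elim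
  have := key (r - 1 - t) (by omega)
  rwa [show r - 1 - (r - 1 - t) = t by omega] at this

end Circle

/-! ### Katona's averaging and uniqueness of the star -/

theorem exists_mem_exchange_notMem {α : Type*} [DecidableEq α] {F : Finset (Finset α)} {A C : Finset α} (hA : A ∈ F)
    (hC : C ∉ F) (h : #A = #C) :
    ∃ A ∈ F, ∃ x ∈ A, ∃ y ∉ A, insert y (A.erase x) ∉ F := by
  induction hd : #(A \ C) generalizing A with
  | zero =>
    rw [card_eq_zero, sdiff_eq_empty_iff_subset] at hd
    exact absurd (eq_of_subset_of_card_le hd h.ge ▸ hA) hC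
  | succ d ih =>
    obtain ⟨x, hx⟩ : (A \ C).Nonempty := by rw [← card_pos]; omega
    obtain ⟨y, hy⟩ : (C \ A).Nonempty := by rw [← card_pos, card_sdiff_comm h.symm]; omega
    rw [mem_sdiff] at hx hy
    by_cases hB : insert y (A.erase x) ∈ F
    · refine ih hB ?_ ?_
      · rw [card_insert_of_notMem (by simp [hy.2]), card_erase_add_one hx.1, h]
      · have : insert y (A.erase x) \ C = (A \ C).erase x := by
          ext z; simp only [mem_sdiff, mem_insert, mem_erase]
          constructor
          · rintro ⟨rfl | h1, h2⟩
            · exact absurd hy.1 h2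
            · exact ⟨h1.1, h1.2, h2⟩
          · rintro ⟨h1, h2, h3⟩; exact ⟨Or.inr ⟨h1, h2⟩, h3⟩
        rw [this, card_erase_of_mem (mem_sdiff.2 hx), hd]; rfl
    · exact ⟨A, hA, x, hx.1, y, hy.2, hB⟩

section Circle

variable {α : Type*} [Fintype α] [DecidableEq α]

theorem exists_perm_map_eq {S S' : Finset α} (h : #S = #S') :
    ∃ τ : Equiv.Perm α, S.map τ.toEmbedding = S' := by
  let e := Finset.equivOfCardEq h
  refine ⟨e.extendSubtype, eq_of_subset_of_card_le ?_ (by simp [h])⟩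
  intro x hx
  obtain ⟨a, ha, rfl⟩ := mem_map.1 hx
  exact e.extendSubtype_mem a ha

/-- Permutations act transitively on sets of a given size, so the images of `T` are equidistributed
among them. -/
theorem card_equiv_map_eq_mul_choose {β : Type*} [Fintype β] [DecidableEq β]
    (hβ : Fintype.card β = Fintype.card α) (T : Finset β) (S : Finset α) (h : #T = #S) :
    #{σ : β ≃ α | T.map σ.toEmbedding = S} * (Fintype.card α).choose #S =
      (Fintype.card α).factorial := by
  have hconst : ∀ S' ∈ powersetCard #S (univ : Finset α),
      #{σ : β ≃ α | T.map σ.toEmbedding = S'} = #{σ : β ≃ α | T.map σ.toEmbedding = S} := by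
    intro S' hS'
    obtain ⟨τ, hτ⟩ := exists_perm_map_eq (mem_powersetCard.1 hS').2
    refine card_bij' (fun σ _ => σ.trans τ) (fun σ _ => σ.trans τ.symm) ?_ ?_ ?_ ?_
    · intro σ hσ
      simp only [mem_filter, mem_univ, true_and] at hσ ⊢
      rw [← hτ, ← hσ, map_map]; rfl
    · intro σ hσ
      simp only [mem_filter, mem_univ, true_and] at hσ ⊢
      have : T.map (σ.trans τ.symm).toEmbedding = (T.map σ.toEmbedding).map τ.symm.toEmbedding := by
        rw [map_map]; rfl
      rw [this, hσ, ← hτ, map_map]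
      ext; simp
    · intro σ _; ext; simp
    · intro σ _; ext; simp
  have htot := card_eq_sum_card_fiberwise (s := (univ : Finset (β ≃ α)))
    (t := powersetCard #S (univ : Finset α)) (f := fun σ => T.map σ.toEmbedding)
    (by intro σ _; simp [mem_powersetCard, h])
  rw [sum_congr rfl hconst, sum_const, card_powersetCard, card_univ, card_univ,
    Fintype.card_equiv (Fintype.equivOfCardEq hβ), hβ, smul_eq_mul] at htot
  rw [htot, mul_comm]

theorem card_filter_mem_powersetCard (x : α) {r : ℕ} (hr : 1 ≤ r) :
    #{S ∈ powersetCard r (univ : Finset α) | x ∈ S} = (Fintype.card α - 1).choose (r - 1) := by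
  have : #(powersetCard (r - 1) (univ.erase x)) = (Fintype.card α - 1).choose (r - 1) := by
    rw [card_powersetCard, card_erase_of_mem (mem_univ x), card_univ]
  rw [← this]
  refine card_bij' (fun S _ => S.erase x) (fun S _ => insert x S) ?_ ?_ ?_ ?_
  · intro S hS
    simp only [mem_filter, mem_powersetCard] at hS
    simp [mem_powersetCard, erase_subset_erase, card_erase_of_mem hS.2, hS.1.2]
  · intro S hS
    simp only [mem_powersetCard] at hS
    have hx : x ∉ S := fun h => by simpa using hS.1 h
    simp [mem_powersetCard, card_insert_of_notMem hx, hS.2, hr]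
  · intro S hS
    exact insert_erase (mem_filter.1 hS).2
  · intro S hS
    simp only [mem_powersetCard] at hS
    exact erase_insert fun h => by simpa using hS.1 h

/-- In an intersecting family of the largest size, every cyclic order of the ground set has as many
arcs from the family as possible. -/
theorem card_arcs_eq {n r : ℕ} [NeZero n] (hα : Fintype.card α = n) (hr : 1 ≤ r) (hn : 2 * r ≤ n)
    {F : Finset (Finset α)} (hF : (F : Set (Finset α)).Intersecting)
    (hs : (F : Set (Finset α)).Sized r) (hcard : #F = (n - 1).choose (r - 1)) (σ : ZMod n ≃ α) :
    #{i : ZMod n | (arc r i).map σ.toEmbedding ∈ F} = r := by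
  have hle : ∀ σ : ZMod n ≃ α, #{i : ZMod n | (arc r i).map σ.toEmbedding ∈ F} ≤ r := by
    intro σ
    refine card_arcs_le hn fun i hi j hj hd => ?_
    simp only [mem_filter, mem_univ, true_and] at hi hj
    exact hF hi hj ((disjoint_map _).2 hd)
  have hβ : Fintype.card (ZMod n) = Fintype.card α := by rw [ZMod.card, hα]
  -- Double counting: since `n * (n - 1).choose (r - 1) = r * n.choose r`, the bound `r` is attained
  -- on average, hence for every `σ`.
  have hsum : (∑ σ : ZMod n ≃ α, #{i : ZMod n | (arc r i).map σ.toEmbedding ∈ F}) =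
      ∑ _σ : ZMod n ≃ α, r := by
    have h1 : (∑ σ : ZMod n ≃ α, #{i : ZMod n | (arc r i).map σ.toEmbedding ∈ F}) =
        ∑ i : ZMod n, ∑ S ∈ F, #{σ : ZMod n ≃ α | (arc r i).map σ.toEmbedding = S} := by
      simp_rw [card_filter]
      rw [sum_comm]
      refine sum_congr rfl fun i _ => ?_
      rw [sum_comm]
      refine sum_congr rfl fun σ _ => ?_
      rw [sum_ite_eq]
    have hpos : 0 < n.choose r := Nat.choose_pos (by omega)
    refine Nat.eq_of_mul_eq_mul_right hpos ?_
    rw [h1, sum_mul]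
    have h2 : ∀ i : ZMod n, (∑ S ∈ F, #{σ : ZMod n ≃ α | (arc r i).map σ.toEmbedding = S}) *
        n.choose r = #F * n.factorial := by
      intro i
      rw [sum_mul, ← smul_eq_mul, ← sum_const]
      refine sum_congr rfl fun S hS => ?_
      have := card_equiv_map_eq_mul_choose hβ (arc r i) S
        (by rw [card_arc (by omega), hs hS])
      rwa [hs hS, hα] at this
    rw [sum_congr rfl fun i _ => h2 i, sum_const, sum_const, card_univ, card_univ, ZMod.card,
      Fintype.card_equiv (Fintype.equivOfCardEq hβ), ZMod.card, smul_eq_mul, smul_eq_mul, hcard]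
    obtain ⟨n', rfl⟩ : ∃ n', n = n' + 1 := ⟨n - 1, by omega⟩
    obtain ⟨r', rfl⟩ : ∃ r', r = r' + 1 := ⟨r - 1, by omega⟩
    have := Nat.add_one_mul_choose_eq n' r'
    simp only [Nat.add_sub_cancel]
    linear_combination (n' + 1).factorial * this
  exact (sum_eq_sum_iff_of_le fun σ _ => hle σ).1 hsum σ (mem_univ σ)

theorem exists_equiv_arc_map_eq {n : ℕ} [NeZero n] (hα : Fintype.card α = n) (l : List α)
    (hl : l.Nodup) (hmem : ∀ a, a ∈ l) :
    ∃ σ : ZMod n ≃ α, ∀ L₁ L₂ L₃ : List α, l = L₁ ++ (L₂ ++ L₃) →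
      (arc L₂.length (L₁.length : ZMod n)).map σ.toEmbedding = L₂.toFinset := by
  have hlen : l.length = n := by
    rw [← hα, ← card_univ, ← List.toFinset_card_of_nodup hl]
    congr 1; ext; simp [hmem]
  let f : ZMod n → α := fun i => l[i.val]'(by rw [hlen]; exact ZMod.val_lt i)
  have hf : Function.Injective f := by
    intro a b hab
    exact ZMod.val_injective n ((List.Nodup.getElem_inj_iff hl).1 hab)
  have hbij : Function.Bijective f :=
    (Fintype.bijective_iff_injective_and_card f).2 ⟨hf, by rw [ZMod.card, hα]⟩
  refine ⟨Equiv.ofBijective f hbij, ?_⟩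
  rintro L₁ L₂ L₃ rfl
  simp only [List.length_append] at hlen
  ext a
  simp only [arc, mem_map, mem_image, mem_range, List.mem_toFinset, Equiv.coe_toEmbedding,
    Equiv.ofBijective_apply, List.mem_iff_getElem]
  have hval : ∀ t, t < L₂.length → ((L₁.length : ZMod n) + (t : ZMod n)).val = L₁.length + t := by
    intro t ht
    rw [← Nat.cast_add, ZMod.val_natCast_of_lt (by omega)]
  constructor
  · rintro ⟨-, ⟨t, ht, rfl⟩, rfl⟩
    refine ⟨t, ht, ?_⟩
    simp [f, hval t ht, List.getElem_append, ht]
  · rintro ⟨t, ht, rfl⟩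
    refine ⟨_, ⟨t, ht, rfl⟩, ?_⟩
    simp [f, hval t ht, List.getElem_append, ht]

/-- If exchanging `x` for `y` in a member leads out of an extremal family, then the family contains
all sets with `x` and without `y`. -/
theorem mem_of_exchange {n r : ℕ} (hα : Fintype.card α = n) (hr : 1 ≤ r) (hn : 2 * r < n)
    {F : Finset (Finset α)} (hF : (F : Set (Finset α)).Intersecting)
    (hs : (F : Set (Finset α)).Sized r) (hcard : #F = (n - 1).choose (r - 1))
    {A : Finset α} (hA : A ∈ F) {x y : α} (hx : x ∈ A) (hy : y ∉ A)
    (hB : insert y (A.erase x) ∉ F) {S : Finset α} (hS : #S = r) (hxS : x ∈ S) (hyS : y ∉ S) :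
    S ∈ F := by
  have : NeZero n := ⟨by omega⟩
  have hAr : #A = r := hs hA
  -- In the cyclic order `y, A \ S, (A ∩ S) \ {x}, x, S \ A, rest`, the arcs of length `r` starting
  -- at `0`, `1` and `P.length + 1` are the exchanged set, `A` and `S`. The first is not in `F` and
  -- the second is, so the run of `r` arcs starts at `1` and reaches `S`.
  let P := (A \ S).toList
  let Q := ((A ∩ S).erase x).toList
  let R := (S \ A).toList
  let Z := (insert y (A ∪ S))ᶜ.toList
  have hPQ : P.length + Q.length + 1 = r := by
    have h1 := card_erase_add_one (mem_inter.2 ⟨hx, hxS⟩)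
    have h2 := card_sdiff_add_card_inter A S
    simp only [P, Q, length_toList]; omega
  have hPR : P.length = R.length := by
    simp only [P, R, length_toList]
    exact card_sdiff_comm (hAr.trans hS.symm)
  obtain ⟨σ, hσ⟩ := exists_equiv_arc_map_eq hα (y :: (P ++ (Q ++ (x :: (R ++ Z)))))
    (by
      simp only [List.nodup_cons, List.nodup_append, List.mem_append, List.mem_cons, P, Q, R, Z,
        mem_toList, mem_sdiff, mem_erase, mem_inter, mem_compl, mem_insert, mem_union,
        Finset.nodup_toList]
      grind)
    (by
      intro a
      simp only [List.mem_append, List.mem_cons, P, Q, R, Z,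
        mem_toList, mem_sdiff, mem_erase, mem_inter, mem_compl, mem_insert, mem_union]
      grind)
  have harcs := card_arcs_eq hα hr hn.le hF hs hcard σ
  have e0 := hσ [] (y :: (P ++ Q)) (x :: (R ++ Z)) (by simp)
  have e1 := hσ [y] (P ++ (Q ++ [x])) (R ++ Z) (by simp)
  have e2 := hσ (y :: P) (Q ++ (x :: R)) Z (by simp)
  simp only [List.length_cons, List.length_append, List.length_nil] at e0 e1 e2
  rw [show P.length + Q.length + 1 = r by omega] at e0
  rw [show P.length + (Q.length + (0 + 1)) = r by omega] at e1
  rw [show Q.length + (R.length + 1) = r by omega] at e2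
  have f0 : (y :: (P ++ Q)).toFinset = insert y (A.erase x) := by
    ext a; simp [P, Q]; grind
  have f1 : (P ++ (Q ++ [x])).toFinset = A := by
    ext a; simp [P, Q]; grind
  have f2 : (Q ++ (x :: R)).toFinset = S := by
    ext a; simp [R, Q]; grind
  rw [f0] at e0
  rw [f1] at e1
  rw [f2] at e2
  have := mem_of_card_arcs_eq hn (I := {i : ZMod n | (arc r i).map σ.toEmbedding ∈ F})
    (fun i hi j hj hd => by
      simp only [mem_filter, mem_univ, true_and] at hi hj
      exact hF hi hj ((disjoint_map _).2 hd)) harcs (i := 1)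
    (by simpa [← e1] using hA) (by simpa [← e0] using hB) (t := P.length) (by omega)
  rw [← e2]
  simpa [add_comm] using this

/-- The families attaining equality in the Erdős–Ko–Rado theorem are the full stars. -/
theorem exists_eq_star {n r : ℕ} (hα : Fintype.card α = n) (hr : 1 ≤ r) (hn : 2 * r < n)
    {F : Finset (Finset α)} (hF : (F : Set (Finset α)).Intersecting)
    (hs : (F : Set (Finset α)).Sized r) (hcard : #F = (n - 1).choose (r - 1)) :
    ∃ x, F = {S ∈ powersetCard r (univ : Finset α) | x ∈ S} := by
  obtain ⟨A₀, hA₀⟩ : F.Nonempty := by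
    rw [← card_pos, hcard]; exact Nat.choose_pos (by omega)
  obtain ⟨C, hCsub, hC⟩ := exists_subset_card_eq (s := A₀ᶜ) (n := r)
    (by rw [card_compl, hα, hs hA₀]; omega)
  have hCF : C ∉ F := fun h => hF hA₀ h (disjoint_of_subset_right hCsub disjoint_compl_right)
  obtain ⟨A, hA, x, hx, y, hy, hB⟩ := exists_mem_exchange_notMem hA₀ hCF ((hs hA₀).trans hC.symm)
  refine ⟨x, eq_of_subset_of_card_le (fun D hD => ?_)
    (by rw [card_filter_mem_powersetCard x hr, hα, hcard])⟩
  simp only [mem_filter, mem_powersetCard, subset_univ, true_and]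
  refine ⟨hs hD, ?_⟩
  by_contra hxD
  have hxy : x ≠ y := fun h => hy (h ▸ hx)
  -- There is room since `n ≥ 2 * r + 1`; then `insert x S` lies in `F` by exchange but misses `D`.
  obtain ⟨S, hSsub, hS⟩ := exists_subset_card_eq (s := (insert x (insert y D))ᶜ) (n := r - 1) (by
    have h1 := card_insert_le x (insert y D)
    have h2 := card_insert_le y D
    have h3 : #D = r := hs hD
    rw [card_compl, hα]; omega)
  have hS' : ∀ z ∈ S, z ≠ x ∧ z ≠ y ∧ z ∉ D := by
    intro z hz
    simpa [not_or] using hSsub hz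
  have hmem : insert x S ∈ F := by
    refine mem_of_exchange hα hr hn hF hs hcard hA hx hy hB ?_ (mem_insert_self _ _) ?_
    · rw [card_insert_of_notMem fun h => (hS' x h).1 rfl, hS]; omega
    · rw [mem_insert, not_or]
      exact ⟨hxy.symm, fun h => (hS' y h).2.1 rfl⟩
  refine hF hmem hD ?_
  rw [disjoint_left]
  intro z hz
  rcases mem_insert.1 hz with rfl | hz
  · exact hxD
  · exact (hS' z hz).2.2

end Circle

/-! ### Counting multisets by their supports -/

/-- Stripping all copies of `x` leaves a multiset supported on `S`; the multiplicity of `x`, shifted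
by 1 to index `range m`, is the first part. -/
theorem card_filter_toFinset_eq {n : ℕ} (m k : ℕ) (S : Finset (Fin n)) :
    #{A ∈ kMultisets n m k | A.toFinset = S} = boundedComp m k #S := by
  induction S using Finset.induction_on generalizing k with
  | empty =>
    rw [card_empty, boundedComp_zero_right]
    split_ifs with hk
    · rw [card_eq_one]
      refine ⟨0, ?_⟩
      ext A
      simp only [mem_filter, mem_kMultisets, mem_singleton, Multiset.toFinset_eq_empty]
      refine ⟨fun h => h.2, ?_⟩
      rintro rfl
      simp [hk]
    · rw [card_eq_zero, filter_eq_empty_iff]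
      intro A hA h
      rw [Multiset.toFinset_eq_empty] at h
      rw [mem_kMultisets, h] at hA
      exact hk (by simpa using hA.1.symm)
  | insert x S hx ih =>
    rw [card_insert_of_notMem hx, boundedComp_succ, headComp,
      card_eq_sum_card_fiberwise (t := range m) (f := fun A => A.count x - 1)]
    · refine sum_congr rfl fun r hr => ?_
      rw [mem_range] at hr
      split_ifs with hrk
      · rw [← ih]
        refine card_bij' (fun A _ => A.filter (· ≠ x))
          (fun B _ => B + Multiset.replicate (r + 1) x) ?_ ?_ ?_ ?_
        · intro A hA
          simp only [mem_filter, mem_kMultisets] at hA ⊢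
          obtain ⟨⟨⟨hc, hle⟩, hs⟩, hcount⟩ := hA
          have hxA : 0 < A.count x := by
            rw [Multiset.count_pos, ← Multiset.mem_toFinset, hs]; exact mem_insert_self _ _
          refine ⟨⟨?_, fun i => ?_⟩, ?_⟩
          · have h1 := congrArg Multiset.card (Multiset.filter_add_not (fun a => a = x) A)
            rw [Multiset.card_add, Multiset.filter_eq', Multiset.card_replicate] at h1
            change A.count x + (A.filter (· ≠ x)).card = A.card at h1
            omega
          · refine le_trans ?_ (hle i)
            exact_mod_cast Multiset.count_le_of_le i (Multiset.filter_le _ _)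
          · rw [Multiset.toFinset_filter, hs]
            ext z; simp only [mem_filter, mem_insert]
            refine ⟨fun h => h.1.resolve_left h.2, fun h => ⟨Or.inr h, ?_⟩⟩
            rintro rfl; exact hx h
        · intro B hB
          simp only [mem_filter, mem_kMultisets] at hB ⊢
          obtain ⟨⟨hc, hle⟩, hs⟩ := hB
          have hxB : B.count x = 0 := by
            rw [Multiset.count_eq_zero, ← Multiset.mem_toFinset, hs]; exact hx
          refine ⟨⟨⟨?_, fun i => ?_⟩, ?_⟩, ?_⟩
          · rw [Multiset.card_add, Multiset.card_replicate]; omega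
          · rw [Multiset.count_add, Multiset.count_replicate]
            split_ifs with h
            · subst h
              rw [hxB]; exact_mod_cast (by omega : 0 + (r + 1) ≤ m)
            · exact hle i
          · rw [Multiset.toFinset_add, hs, Multiset.toFinset_replicate, if_neg (by omega)]
            ext z; simp
          · rw [Multiset.count_add, hxB, Multiset.count_replicate_self]; omega
        · intro A hA
          simp only [mem_filter, mem_kMultisets] at hA
          obtain ⟨⟨⟨hc, hle⟩, hs⟩, hcount⟩ := hA
          have hxA : 0 < A.count x := by
            rw [Multiset.count_pos, ← Multiset.mem_toFinset, hs]; exact mem_insert_self _ _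
          rw [show r + 1 = A.count x by omega, ← Multiset.filter_eq', add_comm]
          exact Multiset.filter_add_not (fun a => a = x) A
        · intro B hB
          simp only [mem_filter, mem_kMultisets] at hB
          obtain ⟨⟨hc, hle⟩, hs⟩ := hB
          have hxB : x ∉ B := by rw [← Multiset.mem_toFinset, hs]; exact hx
          rw [Multiset.filter_add, Multiset.filter_eq_self.2, Multiset.filter_eq_nil.2, add_zero]
          · intro a ha
            simp [Multiset.eq_of_mem_replicate ha]
          · rintro a ha rfl; exact hxB ha
      · rw [card_eq_zero, filter_eq_empty_iff]
        intro A hA h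
        simp only [mem_filter, mem_kMultisets] at hA
        obtain ⟨⟨hc, hle⟩, hs⟩ := hA
        have hxA : 0 < A.count x := by
          rw [Multiset.count_pos, ← Multiset.mem_toFinset, hs]; exact mem_insert_self _ _
        have := Multiset.count_le_card x A
        omega
    · intro A hA
      simp only [coe_filter, mem_kMultisets, Set.mem_ofPred_eq] at hA
      obtain ⟨⟨hc, hle⟩, hs⟩ := hA
      have hxA : 0 < A.count x := by
        rw [Multiset.count_pos, ← Multiset.mem_toFinset, hs]; exact mem_insert_self _ _
      have : A.count x ≤ m := by exact_mod_cast hle x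
      simp only [coe_range, Set.mem_Iio]; omega

theorem card_filter_toFinset_mem {n : ℕ} (m k : ℕ) (𝓕 : Finset (Finset (Fin n))) :
    #{A ∈ kMultisets n m k | A.toFinset ∈ 𝓕} =
      ∑ j ∈ range (n + 1), #{S ∈ 𝓕 | #S = j} * boundedComp m k j := by
  rw [card_eq_sum_card_fiberwise (t := 𝓕) (f := Multiset.toFinset)
    (by intro A hA; exact (mem_filter.1 hA).2)]
  have h1 : ∀ S ∈ 𝓕, #{A ∈ {A ∈ kMultisets n m k | A.toFinset ∈ 𝓕} | A.toFinset = S} =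
      boundedComp m k #S := by
    intro S hS
    rw [← card_filter_toFinset_eq, filter_filter]
    congr 1
    refine filter_congr fun A _ => ⟨fun h => h.2, fun h => ⟨h ▸ hS, h⟩⟩
  rw [sum_congr rfl h1, ← sum_fiberwise_of_maps_to (t := range (n + 1)) (g := card)
    (fun S _ => mem_range.2 (Nat.lt_succ_of_le (by simpa using card_le_univ S)))]
  refine sum_congr rfl fun j _ => ?_
  rw [← smul_eq_mul, ← sum_const]
  exact sum_congr rfl fun S hS => by rw [(mem_filter.1 hS).2]

/-! ### Level sizes of intersecting families of sets -/

section Levels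

variable {n : ℕ} {𝓕 : Finset (Finset (Fin n))}

theorem card_level_star (x : Fin n) {j : ℕ} (hj : 1 ≤ j) :
    #{S ∈ {S : Finset (Fin n) | x ∈ S} | #S = j} = (n - 1).choose (j - 1) := by
  have h := card_filter_mem_powersetCard x hj
  rw [Fintype.card_fin] at h
  rw [← h]
  congr 1
  ext S
  simp [mem_powersetCard, and_comm]

theorem card_level_star_add (x : Fin n) {i j : ℕ} (hi : 1 ≤ i) (hj : 1 ≤ j) (hij : i + j = n) :
    #{S ∈ {S : Finset (Fin n) | x ∈ S} | #S = i} +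
      #{S ∈ {S : Finset (Fin n) | x ∈ S} | #S = j} = n.choose i := by
  rw [card_level_star x hi, card_level_star x hj]
  obtain ⟨i, rfl⟩ : ∃ i', i = i' + 1 := ⟨i - 1, by omega⟩
  obtain ⟨n, rfl⟩ : ∃ n', n = n' + 1 := ⟨n - 1, by omega⟩
  rw [Nat.choose_succ_succ, show n + 1 - 1 = n by omega, show i + 1 - 1 = i by omega,
    Nat.choose_symm_of_eq_add (show n = (j - 1) + (i + 1) by omega)]

/-- The complement of a member is never a member, so level `i` and the complements of level `j` are
disjoint collections of `i`-sets. -/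
theorem card_level_add_le (h𝓕 : (𝓕 : Set (Finset (Fin n))).Intersecting) {i j : ℕ}
    (hij : i + j = n) : #{S ∈ 𝓕 | #S = i} + #{S ∈ 𝓕 | #S = j} ≤ n.choose i := by
  have hcompl : #{S ∈ 𝓕 | #S = j} = #({S ∈ 𝓕 | #S = j}.image compl) :=
    (card_image_of_injective _ compl_injective).symm
  rw [hcompl, ← card_union_of_disjoint]
  · refine (card_le_card (t := powersetCard i (univ : Finset (Fin n))) ?_).trans (by simp)
    intro S hS
    rw [mem_powersetCard]
    refine ⟨subset_univ _, ?_⟩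
    rcases mem_union.1 hS with h | h
    · exact (mem_filter.1 h).2
    · obtain ⟨T, hT, rfl⟩ := mem_image.1 h
      rw [card_compl, (mem_filter.1 hT).2, Fintype.card_fin]; omega
  · rw [disjoint_left]
    intro S hS hS'
    obtain ⟨T, hT, rfl⟩ := mem_image.1 hS'
    exact h𝓕 (mem_filter.1 hS).1 (mem_filter.1 hT).1 disjoint_compl_left

theorem card_level_le (h𝓕 : (𝓕 : Set (Finset (Fin n))).Intersecting) (x : Fin n) {i : ℕ}
    (hi : 1 ≤ i) (hn : 2 * i ≤ n) :
    #{S ∈ 𝓕 | #S = i} ≤ #{S ∈ {S : Finset (Fin n) | x ∈ S} | #S = i} := by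
  rw [card_level_star x hi]
  refine erdos_ko_rado (h𝓕.mono ?_) ?_ (by omega)
  · exact_mod_cast filter_subset _ _
  · intro S hS
    exact (mem_filter.1 (mem_coe.1 hS)).2

/-- Weighted comparison of a pair of complementary levels of an intersecting family with those of a
star. -/
theorem level_pair_le (h𝓕 : (𝓕 : Set (Finset (Fin n))).Intersecting) (x : Fin n) {i j : ℕ}
    {w : ℕ → ℕ} (hi : 1 ≤ i) (hij : i ≤ j) (hn : i + j = n) (hw : w j ≤ w i) :
    #{S ∈ 𝓕 | #S = i} * w i + #{S ∈ 𝓕 | #S = j} * w j +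
        (w i - w j) *
          (#{S ∈ {S : Finset (Fin n) | x ∈ S} | #S = i} - #{S ∈ 𝓕 | #S = i}) ≤
      #{S ∈ {S : Finset (Fin n) | x ∈ S} | #S = i} * w i +
        #{S ∈ {S : Finset (Fin n) | x ∈ S} | #S = j} * w j := by
  have h1 := card_level_le h𝓕 x hi (by omega)
  have h2 := card_level_add_le h𝓕 hn
  rw [← card_level_star_add x hi (hi.trans hij) hn] at h2
  obtain ⟨d, hd⟩ := Nat.exists_eq_add_of_le hw
  obtain ⟨e, he⟩ := Nat.exists_eq_add_of_le h1
  rw [hd, he, Nat.add_sub_cancel_left, Nat.add_sub_cancel_left]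
  rw [he] at h2
  -- Write the weighted sum as `w j` times the joint size plus `w i - w j` times the size of level
  -- `i`. The second part yields the excess term, which is needed for equality.
  nlinarith [Nat.mul_le_mul_right (w j) h2]

end Levels

/-! ### The star bound for finite multiplicities -/

section Finite

variable {n m k c : ℕ} {𝓕 : Finset (Finset (Fin n))}

theorem boundedComp_pair_le (hk : 2 ≤ k) (hc : 1 ≤ c) (hkc : k ≤ c * m) (hn : k + c ≤ n)
    (h𝓕 : (𝓕 : Set (Finset (Fin n))).Intersecting) (x : Fin n) {i j : ℕ} (hij : i + j = n) :
    #{S ∈ 𝓕 | #S = i} * boundedComp m k i + #{S ∈ 𝓕 | #S = j} * boundedComp m k j ≤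
      #{S ∈ {S : Finset (Fin n) | x ∈ S} | #S = i} * boundedComp m k i +
        #{S ∈ {S : Finset (Fin n) | x ∈ S} | #S = j} * boundedComp m k j := by
  wlog hle : i ≤ j generalizing i j
  · have := this (i := j) (j := i) (by omega) (by omega)
    omega
  rcases Nat.eq_zero_or_pos i with rfl | hi
  · have h0 : boundedComp m k 0 = 0 := by rw [boundedComp_zero_right, if_neg (by omega)]
    rw [h0, boundedComp_eq_zero_of_lt (show k < j by omega)]
    simp
  · have hw : boundedComp m k j ≤ boundedComp m k i := by
      rcases hle.eq_or_lt with rfl | hlt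
      · exact le_rfl
      · exact boundedComp_le_boundedComp hc hkc hi hlt (by omega)
    exact le_trans (Nat.le_add_right _ _) (level_pair_le h𝓕 x hi hle hij hw)

/-- Doubling pairs `j` with `n - j` without treating a middle level separately. -/
theorem two_mul_sum_range_reflect (n : ℕ) (f : ℕ → ℕ) :
    2 * ∑ j ∈ range (n + 1), f j = ∑ j ∈ range (n + 1), (f j + f (n - j)) := by
  have := sum_range_reflect f (n + 1)
  simp only [Nat.add_sub_cancel] at this
  rw [sum_add_distrib, this, two_mul]

theorem card_filter_toFinset_mem_le (hk : 2 ≤ k) (hc : 1 ≤ c) (hkc : k ≤ c * m) (hn : k + c ≤ n)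
    (h𝓕 : (𝓕 : Set (Finset (Fin n))).Intersecting) (x : Fin n) :
    #{A ∈ kMultisets n m k | A.toFinset ∈ 𝓕} ≤
      #{A ∈ kMultisets n m k | A.toFinset ∈ ({S | x ∈ S} : Finset (Finset (Fin n)))} := by
  rw [card_filter_toFinset_mem, card_filter_toFinset_mem]
  refine le_of_mul_le_mul_left ?_ two_pos
  rw [two_mul_sum_range_reflect, two_mul_sum_range_reflect]
  refine sum_le_sum fun j hj => ?_
  rw [mem_range] at hj
  exact boundedComp_pair_le hk hc hkc hn h𝓕 x (by omega)

theorem exists_forall_mem_of_card_eq (hk : 2 ≤ k) (hc : 1 ≤ c) (hkc : k ≤ c * m)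
    (hn : k + c ≤ n) (hcn : 2 * c < n) (hw : boundedComp m k (n - c) < boundedComp m k c)
    (h𝓕 : (𝓕 : Set (Finset (Fin n))).Intersecting) (hsize : ∀ S ∈ 𝓕, #S ≤ k) (x : Fin n)
    (heq : #{A ∈ kMultisets n m k | A.toFinset ∈ 𝓕} =
      #{A ∈ kMultisets n m k | A.toFinset ∈ ({S | x ∈ S} : Finset (Finset (Fin n)))}) :
    ∃ y, ∀ S ∈ 𝓕, y ∈ S := by
  rw [card_filter_toFinset_mem, card_filter_toFinset_mem] at heq
  replace heq := congrArg (2 * ·) heq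
  simp only [two_mul_sum_range_reflect] at heq
  -- Equality of the totals forces equality in every pair; at the pair `c`, `n - c` the excess term
  -- must vanish.
  have hpair := (sum_eq_sum_iff_of_le fun j hj => by
    rw [mem_range] at hj
    exact boundedComp_pair_le hk hc hkc hn h𝓕 x (by omega)).1 heq c (mem_range.2 (by omega))
  have hlev := level_pair_le h𝓕 x (w := boundedComp m k) hc (show c ≤ n - c by omega) (by omega)
    hw.le
  rw [hpair] at hlev
  have hzero : (boundedComp m k c - boundedComp m k (n - c)) *
      (#{S ∈ {S : Finset (Fin n) | x ∈ S} | #S = c} - #{S ∈ 𝓕 | #S = c}) = 0 := by omega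
  have hle := card_level_le h𝓕 x hc hcn.le
  have hcard : #{S ∈ 𝓕 | #S = c} = (n - 1).choose (c - 1) := by
    rw [← card_level_star x hc]
    rcases Nat.mul_eq_zero.1 hzero with h | h <;> omega
  obtain ⟨y, hy⟩ := exists_eq_star (Fintype.card_fin n) hc hcn
    (F := {S ∈ 𝓕 | #S = c}) (h𝓕.mono (by exact_mod_cast filter_subset _ _))
    (fun S hS => (mem_filter.1 (mem_coe.1 hS)).2) hcard
  refine ⟨y, fun S hS => ?_⟩
  by_contra hyS
  -- As `#S ≤ k` and `k + c ≤ n`, some `c`-set through `y` avoids `S`.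
  obtain ⟨T, hTsub, hT⟩ := exists_subset_card_eq (s := (insert y S)ᶜ) (n := c - 1) (by
    have := hsize S hS
    rw [card_compl, card_insert_of_notMem hyS, Fintype.card_fin]; omega)
  have hT' : ∀ z ∈ T, z ≠ y ∧ z ∉ S := fun z hz => by simpa [not_or] using hTsub hz
  have hmem : insert y T ∈ ({S ∈ 𝓕 | #S = c} : Finset (Finset (Fin n))) := by
    rw [hy, mem_filter, mem_powersetCard]
    refine ⟨⟨subset_univ _, ?_⟩, mem_insert_self _ _⟩
    rw [card_insert_of_notMem fun h => (hT' y h).1 rfl, hT]; omega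
  refine h𝓕 (mem_filter.1 hmem).1 hS ?_
  rw [disjoint_left]
  intro z hz
  rcases mem_insert.1 hz with rfl | hz
  · exact hyS
  · exact (hT' z hz).2

end Finite

/-! ### Reduction of the general statement -/

theorem intersecting_image_toFinset {n : ℕ} {𝒜 : Finset (Multiset (Fin n))}
    (h : IsTIntersecting 1 𝒜) :
    ((𝒜.image Multiset.toFinset : Finset (Finset (Fin n))) : Set (Finset (Fin n))).Intersecting := by
  intro S hS T hT hd
  obtain ⟨A, hA, rfl⟩ := mem_image.1 (mem_coe.1 hS)
  obtain ⟨B, hB, rfl⟩ := mem_image.1 (mem_coe.1 hT)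
  obtain ⟨z, hz⟩ := Multiset.card_pos_iff_exists_mem.1 (h A hA B hB)
  rw [Multiset.mem_inter] at hz
  exact disjoint_left.1 hd (Multiset.mem_toFinset.2 hz.1) (Multiset.mem_toFinset.2 hz.2)

theorem frankl_zero_one {n : ℕ} (m : ℕ∞) (k : ℕ) (hn : 0 < n) :
    frankl n m k 0 1 = {A ∈ kMultisets n m k | (⟨0, hn⟩ : Fin n) ∈ A} := by
  rw [frankl]
  refine filter_congr fun A _ => ?_
  rw [show (0 + 1 ≤ (A ∩ initSeg n (2 * 0 + 1)).card) ↔ 0 < (A ∩ initSeg n 1).card from Iff.rfl,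
    Multiset.card_pos_iff_exists_mem]
  simp only [Multiset.mem_inter, initSeg, mem_val, mem_filter, mem_univ, true_and]
  constructor
  · rintro ⟨a, ha, h0⟩
    have : a = ⟨0, hn⟩ := Fin.ext (by simpa using h0)
    exact this ▸ ha
  · intro h
    exact ⟨_, h, by simp⟩

theorem isomorphic_star {n : ℕ} (m : ℕ∞) (k : ℕ) (x y : Fin n) :
    Isomorphic {A ∈ kMultisets n m k | x ∈ A} {A ∈ kMultisets n m k | y ∈ A} := by
  have hmap : ∀ x y : Fin n, ∀ A ∈ kMultisets n m k, x ∈ A →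
      A.map (Equiv.swap x y) ∈ kMultisets n m k ∧ y ∈ A.map (Equiv.swap x y) := by
    intro x y A hA hx
    rw [mem_kMultisets] at hA ⊢
    refine ⟨⟨by rw [Multiset.card_map]; exact hA.1, fun i => ?_⟩,
      Multiset.mem_map.2 ⟨x, hx, Equiv.swap_apply_left x y⟩⟩
    have := Multiset.count_map_eq_count' (Equiv.swap x y) A (Equiv.swap x y).injective
      (Equiv.swap x y i)
    rw [Equiv.swap_apply_self] at this
    rw [this]
    exact hA.2 _
  refine ⟨Equiv.swap x y, ?_⟩
  ext A
  simp only [mem_filter, mem_image]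
  constructor
  · rintro ⟨hA, hy⟩
    refine ⟨A.map (Equiv.swap x y), ?_, ?_⟩
    · have := hmap y x A hA hy
      rwa [Equiv.swap_comm] at this
    · rw [Multiset.map_map]
      simp
  · rintro ⟨B, ⟨hB, hx⟩, rfl⟩
    exact hmap x y B hB hx

theorem Isomorphic.card_eq {n : ℕ} {𝒜₁ 𝒜₂ : Finset (Multiset (Fin n))}
    (h : Isomorphic 𝒜₁ 𝒜₂) : #𝒜₁ = #𝒜₂ := by
  obtain ⟨σ, rfl⟩ := h
  exact (card_image_of_injective _ (Multiset.map_injective σ.injective)).symm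

theorem card_le_and_isomorphic {n m k c : ℕ} (hk : 2 ≤ k) (hc : 1 ≤ c)
    (hkc : k ≤ c * m) (hn : k + c ≤ n) {𝒜 : Finset (Multiset (Fin n))}
    (h𝒜 : 𝒜 ⊆ kMultisets n m k) (hint : IsTIntersecting 1 𝒜) :
    #𝒜 ≤ #(frankl n m k 0 1) ∧
      (2 * c < n → boundedComp m k (n - c) < boundedComp m k c →
        (#𝒜 = #(frankl n m k 0 1) ↔ Isomorphic 𝒜 (frankl n m k 0 1))) := by
  have hn0 : 0 < n := by omega
  set x : Fin n := ⟨0, hn0⟩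
  set 𝓕 := 𝒜.image Multiset.toFinset with h𝓕def
  have h𝓕 := intersecting_image_toFinset hint
  have hstar : frankl n m k 0 1 =
      {A ∈ kMultisets n m k | A.toFinset ∈ ({S | x ∈ S} : Finset (Finset (Fin n)))} := by
    rw [frankl_zero_one _ _ hn0]
    refine filter_congr fun A _ => ?_
    simp [x]
  have hsub : 𝒜 ⊆ {A ∈ kMultisets n m k | A.toFinset ∈ 𝓕} := fun A hA =>
    mem_filter.2 ⟨h𝒜 hA, mem_image_of_mem _ hA⟩
  have hle := card_filter_toFinset_mem_le hk hc hkc hn h𝓕 x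
  rw [← hstar] at hle
  refine ⟨(card_le_card hsub).trans hle, fun hcn hw => ⟨fun heq => ?_, Isomorphic.card_eq⟩⟩
  have hsize : ∀ S ∈ 𝓕, #S ≤ k := by
    intro S hS
    obtain ⟨A, hA, rfl⟩ := mem_image.1 hS
    rw [← (mem_kMultisets.1 (h𝒜 hA)).1]
    exact Multiset.toFinset_card_le A
  obtain ⟨y, hy⟩ := exists_forall_mem_of_card_eq hk hc hkc hn hcn hw h𝓕 hsize x
    (by rw [← hstar]; exact le_antisymm hle (heq ▸ card_le_card hsub))
  have h𝒜y : 𝒜 = {A ∈ kMultisets n m k | y ∈ A} := by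
    refine eq_of_subset_of_card_le (fun A hA => mem_filter.2 ⟨h𝒜 hA, ?_⟩) ?_
    · exact Multiset.mem_toFinset.1 (hy _ (mem_image_of_mem _ hA))
    · rw [heq, frankl_zero_one _ _ hn0, (isomorphic_star m k y ⟨0, hn0⟩).card_eq]
  rw [h𝒜y, frankl_zero_one _ _ hn0]
  exact isomorphic_star _ _ _ _

/-- No multiplicity exceeds `k`, so the unbounded case is `m = k`, with `c = 1`. -/
theorem kMultisets_top (n k : ℕ) : kMultisets n ⊤ k = kMultisets n k k := by
  ext A
  simp only [mem_kMultisets, le_top, implies_true, and_true, Nat.cast_le]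
  refine ⟨fun h => ⟨h, fun i => h ▸ Multiset.count_le_card i A⟩, fun h => h.1⟩

theorem ceilQuot_natCast {k m : ℕ} (hk : 1 ≤ k) (hm : 1 ≤ m) :
    1 ≤ ceilQuot k m ∧ k ≤ ceilQuot k m * m ∧ (ceilQuot k m - 1) * m < k := by
  have hm' : (0 : ℚ) < m := by exact_mod_cast hm
  have hk' : (0 : ℚ) < k := by exact_mod_cast hk
  have hdef : ceilQuot k m = ⌈(k : ℚ) / (m : ℚ)⌉₊ := by simp [ceilQuot]
  have hpos : 1 ≤ ceilQuot k m := by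
    rw [hdef, Nat.one_le_ceil_iff]; positivity
  refine ⟨hpos, ?_, ?_⟩
  · have := Nat.le_ceil ((k : ℚ) / (m : ℚ))
    rw [← hdef, div_le_iff₀ hm'] at this
    exact_mod_cast this
  · have : ceilQuot k m - 1 < ⌈(k : ℚ) / (m : ℚ)⌉₊ := by omega
    rw [Nat.lt_ceil, lt_div_iff₀ hm'] at this
    exact_mod_cast this

end MultisetEKR

theorem theorem1p5 (k n : ℕ) (m : ℕ∞) (hk : 2 ≤ k) (hm : 1 ≤ m)
    (hn : k + MultisetEKR.ceilQuot k m ≤ n)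
    (𝒜 : Finset (Multiset (Fin n))) (h𝒜 : 𝒜 ⊆ MultisetEKR.kMultisets n m k)
    (hint : MultisetEKR.IsTIntersecting 1 𝒜) :
    𝒜.card ≤ (MultisetEKR.frankl n m k 0 1).card ∧
      ((k + MultisetEKR.ceilQuot k m < n ∨
          (n = k + MultisetEKR.ceilQuot k m ∧ m < (k : ℕ∞) ∧ ¬ m ∣ (k : ℕ∞))) →
        (𝒜.card = (MultisetEKR.frankl n m k 0 1).card ↔
          MultisetEKR.Isomorphic 𝒜 (MultisetEKR.frankl n m k 0 1))) := by
  open MultisetEKR in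
  induction m using ENat.recTopCoe with
  | top =>
    have hc : ceilQuot k ⊤ = 1 := by simp [ceilQuot]
    rw [hc] at hn ⊢
    have hfr : frankl n ⊤ k 0 1 = frankl n k k 0 1 := by rw [frankl, frankl, kMultisets_top]
    rw [kMultisets_top] at h𝒜
    rw [hfr]
    obtain ⟨h1, h2⟩ := card_le_and_isomorphic hk le_rfl (by omega) hn h𝒜 hint
    refine ⟨h1, ?_⟩
    rintro (h | ⟨-, h, -⟩)
    · refine h2 (by omega) ?_
      rw [boundedComp_eq_zero_of_lt (by omega)]
      exact boundedComp_pos (by omega) (by omega)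
    · exact absurd h not_top_lt
  | coe m =>
    have hm' : 1 ≤ m := by exact_mod_cast hm
    obtain ⟨hc1, hkc, hcm⟩ := ceilQuot_natCast (show 1 ≤ k by omega) hm'
    set c := ceilQuot k m
    have hck : c ≤ k := by
      have := Nat.le_mul_of_pos_right (c - 1) hm'
      omega
    obtain ⟨h1, h2⟩ := card_le_and_isomorphic hk hc1 hkc hn h𝒜 hint
    refine ⟨h1, ?_⟩
    rintro (h | ⟨h, hmk, hdvd⟩)
    · refine h2 (by omega) ?_
      -- Here `n - c > k`: supports that large carry no `k`-multiset, while those of size `c` do.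
      rw [boundedComp_eq_zero_of_lt (by omega)]
      exact boundedComp_pos hck hkc
    · have hmk' : m < k := by exact_mod_cast hmk
      have hdvd' : ¬ m ∣ k := by
        rintro ⟨d, rfl⟩
        exact hdvd ⟨d, by push_cast; rfl⟩
      have hm2 : 2 ≤ m := by
        by_contra hlt
        exact hdvd' (by rw [show m = 1 by omega]; exact one_dvd k)
      have hkc' : k < c * m := lt_of_le_of_ne hkc fun he => hdvd' ⟨c, by rw [he, mul_comm]⟩
      have hc2 : 2 ≤ c := by
        by_contra hlt
        rw [show c = 1 by omega] at hkc'
        omega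
      have hck' : c < k := by
        have := Nat.mul_le_mul_left (c - 1) hm2
        omega
      refine h2 (by omega) ?_
      -- A support of size `k` carries at most one multiset; `2 ≤ c < k < c * m` gives at least two
      -- on a support of size `c`.
      rw [show n - c = k by omega]
      exact lt_of_le_of_lt (boundedComp_self_le_one m k) (one_lt_boundedComp hc2 hck' hkc')
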